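/- For $x\in\mathbb{R}^n$ let $N(x)=\{z\in\mathbb{Z}^n : |x_i-z_i|<1 \ (i=1,\dots,n)\}$. For $f:\mathbb{Z}^n\to\mathbb{R}\cup\{+\infty\}$ the local convex extension of $f$ is $$\tilde f(x)=\min\Big\{\sum_{y\in N(x)}\lambda_y f(y) \ :\ \sum_{y\in N(x)}\lambda_y\,y=x,\ \sum_{y\in N(x)}\lambda_y=1,\ \lambda_y\ge 0\ (y\in N(x))\Big\}\qquad(x\in\mathbb{R}^n),$$ with the convention $0\cdot(+\infty)=0$, and $f$ is called integrally convex if $\tilde f$ is convex on $\mathbb{R}^n$. A function $\varphi:\mathbb{Z}^n\to\mathbb{R}\cup\{+\infty\}$ is called separable convex if $\varphi(x)=\varphi_1(x_1)+\cdots+\varphi_n(x_n)$ for some functions $\varphi_i:\mathbb{Z}\to\mathbb{R}\cup\{+\infty\}$ such that $\{t\in\mathbb{Z}:\varphi_i(t)<+\infty\}$ is an integer interval (a set of consecutive integers, possibly empty or unbounded) and $\varphi_i(t-1)+\varphi_i(t+1)\ge 2\varphi_i(t)$ for all $t\in\mathbb{Z}$. **Theorem.** Let $f:\mathbb{Z}^n\to\mathbb{R}\cup\{+\infty\}$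 be integrally convex and let $\varphi:\mathbb{Z}^n\to\mathbb{R}\cup\{+\infty\}$ be separable convex. Suppose that the integer infimal convolution $$(f\,\square\,\varphi)(x)=\inf\{f(y)+\varphi(z) : x=y+z,\ y,z\in\mathbb{Z}^n\}$$ is not equal to $-\infty$ for any $x\in\mathbb{Z}^n$. Then $f\,\square\,\varphi$ is integrally convex. -/

import Mathlib

/-! Functions `ℤⁿ → ℝ ∪ {+∞}` are modelled as `EReal`-valued functions that never take the
value `⊥`; this requirement is part of each convexity predicate below. -/

/-- The integral neighborhood `N(x) = [⌊x⌋, ⌈x⌉] ∩ ℤⁿ` of a real vector `x`. -/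
noncomputable def integralNeighborhood {n : ℕ} (x : Fin n → ℝ) : Finset (Fin n → ℤ) :=
  Finset.Icc (fun i => ⌊x i⌋) (fun i => ⌈x i⌉)

/-- The equivalent description `N(x) = {z ∈ ℤⁿ | |xᵢ - zᵢ| < 1 for all i}`. -/
theorem mem_integralNeighborhood {n : ℕ} (x : Fin n → ℝ) (z : Fin n → ℤ) :
    z ∈ integralNeighborhood x ↔ ∀ i, |x i - (z i : ℝ)| < 1 := by
  simp only [integralNeighborhood, Finset.mem_Icc, Pi.le_def, ← forall_and]
  refine forall_congr' fun i => ?_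
  rw [abs_lt, Int.floor_le_iff, Int.le_ceil_iff]
  constructor
  · rintro ⟨h1, h2⟩
    constructor <;> linarith
  · rintro ⟨h1, h2⟩
    constructor <;> linarith

/-- `lam` restricts on `N(x)` to the coefficients of a convex combination of the points of
`N(x)` that is equal to `x`. Values of `lam` outside `N(x)` play no role. -/
def IsLocalConvexCombination {n : ℕ} (x : Fin n → ℝ) (lam : (Fin n → ℤ) → ℝ) : Prop :=
  (∀ y ∈ integralNeighborhood x, 0 ≤ lam y) ∧
  ∑ y ∈ integralNeighborhood x, lam y = 1 ∧
  ∀ i, ∑ y ∈ integralNeighborhood x, lam y * (y i : ℝ) = x i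

/-- The local convex extension of `f`. In `EReal`, `0 * ⊤ = 0`, so points with coefficient
zero do not contribute. -/
noncomputable def localConvexExtension {n : ℕ} (f : (Fin n → ℤ) → EReal) (x : Fin n → ℝ) :
    EReal :=
  ⨅ (lam : (Fin n → ℤ) → ℝ) (_ : IsLocalConvexCombination x lam),
    ∑ y ∈ integralNeighborhood x, (lam y : EReal) * f y

/-- Convexity on `ℝⁿ` of an extended-real-valued function (used for functions that
do not take the value `⊥`). -/
def IsConvexExtended {n : ℕ} (F : (Fin n → ℝ) → EReal) : Prop :=
  ∀ (x y : Fin n → ℝ) (a b : ℝ), 0 ≤ a → 0 ≤ b → a + b = 1 →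
    F (a • x + b • y) ≤ (a : EReal) * F x + (b : EReal) * F y

/-- Integrally convex functions `ℤⁿ → ℝ ∪ {+∞}`. -/
def IsIntegrallyConvex {n : ℕ} (f : (Fin n → ℤ) → EReal) : Prop :=
  (∀ x, f x ≠ ⊥) ∧ IsConvexExtended (localConvexExtension f)

/-- Univariate discrete convex functions `ℤ → ℝ ∪ {+∞}`: the effective domain is an integer
interval and the second differences are nonnegative. -/
def IsUnivariateDiscreteConvex (ψ : ℤ → EReal) : Prop :=
  (∀ t, ψ t ≠ ⊥) ∧ Set.OrdConnected {t : ℤ | ψ t < ⊤} ∧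
  ∀ t, 2 * ψ t ≤ ψ (t - 1) + ψ (t + 1)

/-- Separable convex functions `ℤⁿ → ℝ ∪ {+∞}`. -/
def IsSeparableConvex {n : ℕ} (φ : (Fin n → ℤ) → EReal) : Prop :=
  ∃ ψ : Fin n → ℤ → EReal, (∀ i, IsUnivariateDiscreteConvex (ψ i)) ∧
    ∀ x, φ x = ∑ i, ψ i (x i)

/-- The integer infimal convolution. -/
noncomputable def integerConvolution {n : ℕ} (f g : (Fin n → ℤ) → EReal) (x : Fin n → ℤ) :
    EReal :=
  ⨅ (y : Fin n → ℤ) (z : Fin n → ℤ) (_ : x = y + z), f y + g z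

/-! ### Extended real sums -/

/-! Write `h = f □ φ`. It suffices that the strict epigraph of the local extension of `h` is the
convex hull of all integer points of the strict epigraph of `h`. Only one inclusion has content. A
point of that hull splits as `(y, s) + (z, ∑ τ i)`, with `(y, s)` in the hull for `f` and each `(z
i, τ i)` in the hull of the graph of `ψ i`. Integral convexity of `f` makes `(y, s)` a combination
of points over `N(y)`, i.e. a random rounding `Y` of `y`; discrete convexity of `ψ i` lets `z i` be
rounded to its floor or ceiling at cost at most `τ i`.

Independent roundings may leave `N(y + z)`, so they are coupled: given `Y`, coordinate `i` of `z` is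
rounded up with a probability affine in `Y i`, chosen so that the sum stays in `N(y + z)`
(`exists_affine_rounding`). By affinity the means depend only on `E Y = y`, so the expected cost is
below `s + ∑ τ i` (`localConvexExtension_integerConvolution_lt`). -/

theorem EReal.sum_ne_bot {ι : Type*} {s : Finset ι} {g : ι → EReal} (h : ∀ i ∈ s, g i ≠ ⊥) :
    ∑ i ∈ s, g i ≠ ⊥ := by
  classical
  induction s using Finset.induction_on with
  | empty => simp
  | insert a s ha ih =>
    rw [Finset.sum_insert ha, EReal.add_ne_bot_iff]
    exact ⟨h a (Finset.mem_insert_self a s), ih fun i hi => h i (Finset.mem_insert_of_mem hi)⟩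

theorem EReal.ne_top_of_sum_ne_top {ι : Type*} {s : Finset ι} {g : ι → EReal}
    (h : ∀ i ∈ s, g i ≠ ⊥) (hs : ∑ i ∈ s, g i ≠ ⊤) : ∀ i ∈ s, g i ≠ ⊤ := by
  classical
  intro i hi
  rw [← Finset.add_sum_erase s g hi, EReal.add_ne_top_iff_ne_top₂ (h i hi)
    (EReal.sum_ne_bot fun j hj => h j (Finset.mem_of_mem_erase hj))] at hs
  exact hs.1

theorem EReal.coe_sum {ι : Type*} (s : Finset ι) (g : ι → ℝ) :
    ((∑ i ∈ s, g i : ℝ) : EReal) = ∑ i ∈ s, (g i : EReal) := by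
  classical
  induction s using Finset.induction_on with
  | empty => simp
  | insert a s ha ih => rw [Finset.sum_insert ha, Finset.sum_insert ha, EReal.coe_add, ih]

/-- Passage to real arithmetic: the default `toReal ⊤ = 0` is harmless because infinite values carry
weight zero. -/
theorem EReal.sum_coe_mul_lt_iff {ι : Type*} {s : Finset ι} {w : ι → ℝ} {g : ι → EReal}
    (hw : ∀ i ∈ s, 0 ≤ w i) (hg : ∀ i, g i ≠ ⊥) (r : ℝ) :
    ∑ i ∈ s, (w i : EReal) * g i < r ↔
      (∀ i ∈ s, w i ≠ 0 → g i ≠ ⊤) ∧ ∑ i ∈ s, w i * (g i).toReal < r := by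
  have key : (∀ i ∈ s, w i ≠ 0 → g i ≠ ⊤) →
      ∑ i ∈ s, (w i : EReal) * g i = ((∑ i ∈ s, w i * (g i).toReal : ℝ) : EReal) := by
    intro h
    rw [EReal.coe_sum]
    refine Finset.sum_congr rfl fun i hi => ?_
    by_cases h0 : w i = 0
    · simp [h0]
    · rw [EReal.coe_mul, EReal.coe_toReal (h i hi h0) (hg i)]
  constructor
  · intro h
    have hfin : ∀ i ∈ s, w i ≠ 0 → g i ≠ ⊤ := by
      intro i hi h0 htop
      refine EReal.ne_top_of_sum_ne_top (g := fun i => (w i : EReal) * g i) ?_ h.ne_top i hi ?_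
      · intro j hj
        rcases (hw j hj).eq_or_lt with h1 | h1
        · simp [← h1]
        · induction hgj : g j with
          | bot => exact absurd hgj (hg j)
          | top => simp [EReal.coe_mul_top_of_pos h1]
          | coe v => rw [← EReal.coe_mul]; exact EReal.coe_ne_bot _
      · simp only [htop]
        exact EReal.coe_mul_top_of_pos ((hw i hi).lt_of_ne' h0)
    refine ⟨hfin, ?_⟩
    rw [key hfin] at h
    exact_mod_cast h
  · rintro ⟨h1, h2⟩
    rw [key h1]
    exact_mod_cast h2

/-! ### Convexity through strict epigraphs -/

/-- Strict epigraphs avoid both `⊤` and the question whether the infimum in the local extension is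
attained. -/
theorem IsConvexExtended.convex_strictEpigraph {n : ℕ} {F : (Fin n → ℝ) → EReal}
    (hF : IsConvexExtended F) (hbot : ∀ x, F x ≠ ⊥) :
    Convex ℝ {p : (Fin n → ℝ) × ℝ | F p.1 < p.2} := by
  rintro ⟨x, r⟩ hx ⟨y, s⟩ hy a b ha hb hab
  simp only [Set.mem_ofPred_eq, Prod.smul_mk, Prod.mk_add_mk, smul_eq_mul] at *
  refine (hF x y a b ha hb hab).trans_lt ?_
  lift F x to ℝ using ⟨hx.ne_top, hbot x⟩ with u
  lift F y to ℝ using ⟨hy.ne_top, hbot y⟩ with v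
  norm_cast at *
  rcases ha.eq_or_lt with rfl | ha
  · have : b = 1 := by linarith
    subst this
    linarith
  · have h1 := mul_lt_mul_of_pos_left hx ha
    have h2 := mul_le_mul_of_nonneg_left hy.le hb
    linarith

theorem isConvexExtended_of_convex_strictEpigraph {n : ℕ} {F : (Fin n → ℝ) → EReal}
    (hF : Convex ℝ {p : (Fin n → ℝ) × ℝ | F p.1 < p.2}) (hbot : ∀ x, F x ≠ ⊥) :
    IsConvexExtended F := by
  intro x y a b ha hb hab
  rcases ha.eq_or_lt with rfl | ha'
  · obtain rfl : b = 1 := by linarith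
    simp
  rcases hb.eq_or_lt with rfl | hb'
  · obtain rfl : a = 1 := by linarith
    simp
  have hne : ∀ c : ℝ, 0 < c → ∀ w, (c : EReal) * F w ≠ ⊥ := by
    intro c hc w
    have := hbot w
    induction hFw : F w with
    | bot => exact absurd hFw this
    | top => simp [EReal.coe_mul_top_of_pos hc]
    | coe v => rw [← EReal.coe_mul]; exact EReal.coe_ne_bot _
  by_cases hx : F x = ⊤
  · rw [hx, EReal.coe_mul_top_of_pos ha', EReal.top_add_of_ne_bot (hne b hb' y)]
    exact le_top
  by_cases hy : F y = ⊤
  · rw [hy, EReal.coe_mul_top_of_pos hb', EReal.add_top_of_ne_bot (hne a ha' x)]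
    exact le_top
  obtain ⟨u, hu⟩ : ∃ u : ℝ, F x = u := ⟨_, (EReal.coe_toReal hx (hbot x)).symm⟩
  obtain ⟨v, hv⟩ : ∃ v : ℝ, F y = v := ⟨_, (EReal.coe_toReal hy (hbot y)).symm⟩
  rw [hu, hv]
  refine EReal.le_of_forall_lt_iff_le.1 fun r hr => ?_
  norm_cast at hr
  set ε := r - (a * u + b * v) with hε
  have hε0 : 0 < ε := by linarith
  have hx' : (x, u + ε) ∈ {p : (Fin n → ℝ) × ℝ | F p.1 < p.2} := by
    simp only [Set.mem_ofPred_eq, hu]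
    exact_mod_cast (by linarith : u < u + ε)
  have hy' : (y, v + ε) ∈ {p : (Fin n → ℝ) × ℝ | F p.1 < p.2} := by
    simp only [Set.mem_ofPred_eq, hv]
    exact_mod_cast (by linarith : v < v + ε)
  have h := hF hx' hy' ha hb hab
  simp only [Set.mem_ofPred_eq, Prod.smul_mk, Prod.mk_add_mk, smul_eq_mul] at h
  have e : a * (u + ε) + b * (v + ε) = r := by
    have : b = 1 - a := by linarith
    subst this
    rw [hε]; ring
  rw [e] at h
  exact h.le

/-! ### The local convex extension -/

/-- The real vector with the given integer coordinates. -/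
def realVector {n : ℕ} (y : Fin n → ℤ) : Fin n → ℝ := fun i => (y i : ℝ)

/-- The strict epigraph of `f` above the integer points of `N(x)`. -/
def localEpigraph {n : ℕ} (f : (Fin n → ℤ) → EReal) (x : Fin n → ℝ) :
    Set ((Fin n → ℝ) × ℝ) :=
  {p | ∃ y ∈ integralNeighborhood x, p.1 = realVector y ∧ f y < p.2}

theorem localConvexExtension_lt_iff {n : ℕ} {f : (Fin n → ℤ) → EReal} (hf : ∀ y, f y ≠ ⊥)
    (x : Fin n → ℝ) (r : ℝ) :
    localConvexExtension f x < r ↔ ∃ lam, IsLocalConvexCombination x lam ∧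
      (∀ y ∈ integralNeighborhood x, lam y ≠ 0 → f y ≠ ⊤) ∧
      ∑ y ∈ integralNeighborhood x, lam y * (f y).toReal < r := by
  simp only [localConvexExtension, iInf_lt_iff, exists_prop]
  refine exists_congr fun lam => and_congr_right fun h => ?_
  exact EReal.sum_coe_mul_lt_iff h.1 hf r

/-- The weights lie in `[0, 1]` on a finite set, so `-∑ |f y|` bounds every admissible real sum from
below. -/
theorem localConvexExtension_ne_bot {n : ℕ} {f : (Fin n → ℤ) → EReal} (hf : ∀ y, f y ≠ ⊥)
    (x : Fin n → ℝ) : localConvexExtension f x ≠ ⊥ := by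
  intro h
  obtain ⟨lam, ⟨h0, h1, -⟩, -, h2⟩ := (localConvexExtension_lt_iff hf x
    (∑ y ∈ integralNeighborhood x, -|(f y).toReal|)).1 (h ▸ EReal.bot_lt_coe _)
  refine h2.not_ge (Finset.sum_le_sum fun y hy => ?_)
  have hle : lam y ≤ 1 := h1 ▸ Finset.single_le_sum h0 hy
  have h3 := neg_abs_le (lam y * (f y).toReal)
  rw [abs_mul, abs_of_nonneg (h0 y hy)] at h3
  nlinarith [abs_nonneg (f y).toReal]

theorem mem_convexHull_localEpigraph {n : ℕ} {f : (Fin n → ℤ) → EReal} (hf : ∀ y, f y ≠ ⊥)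
    (x : Fin n → ℝ) (r : ℝ) :
    (x, r) ∈ convexHull ℝ (localEpigraph f x) ↔ localConvexExtension f x < r := by
  classical
  rw [localConvexExtension_lt_iff hf]
  constructor
  · intro h
    -- The barycentre `p.1` is free while the neighborhood stays that of `x`; this makes `D` convex.
    let D : Set ((Fin n → ℝ) × ℝ) := {p | ∃ lam : (Fin n → ℤ) → ℝ,
      ((∀ y ∈ integralNeighborhood x, 0 ≤ lam y) ∧
        ∑ y ∈ integralNeighborhood x, lam y = 1 ∧
        ∀ i, ∑ y ∈ integralNeighborhood x, lam y * (y i : ℝ) = p.1 i) ∧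
      (∀ y ∈ integralNeighborhood x, lam y ≠ 0 → f y ≠ ⊤) ∧
      ∑ y ∈ integralNeighborhood x, lam y * (f y).toReal < p.2}
    have hD : Convex ℝ D := by
      rintro ⟨u, s⟩ ⟨l, ⟨l0, l1, l2⟩, l3, l4⟩ ⟨v, t⟩ ⟨m, ⟨m0, m1, m2⟩, m3, m4⟩ a b ha hb hab
      have lin : ∀ c : (Fin n → ℤ) → ℝ,
          ∑ y ∈ integralNeighborhood x, (a * l y + b * m y) * c y =
          a * ∑ y ∈ integralNeighborhood x, l y * c y +
          b * ∑ y ∈ integralNeighborhood x, m y * c y := by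
        intro c
        rw [Finset.mul_sum, Finset.mul_sum, ← Finset.sum_add_distrib]
        exact Finset.sum_congr rfl fun y _ => by ring
      refine ⟨fun y => a * l y + b * m y, ⟨fun y hy => ?_, ?_, fun i => ?_⟩, fun y hy h0 => ?_, ?_⟩
      · have := l0 y hy
        have := m0 y hy
        positivity
      · have := lin fun _ => 1
        simpa [l1, m1, hab] using this
      · rw [lin, l2, m2]
        simp
      · by_cases hl : l y = 0
        · refine m3 y hy fun hm => h0 ?_
          simp [hl, hm]
        · exact l3 y hy hl
      · rw [lin]
        simp only [Prod.smul_mk, Prod.mk_add_mk, smul_eq_mul] at l4 m4 ⊢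
        rcases ha.eq_or_lt with rfl | ha
        · obtain rfl : b = 1 := by linarith
          linarith
        · have h1 := mul_lt_mul_of_pos_left l4 ha
          have h2 := mul_le_mul_of_nonneg_left m4.le hb
          linarith
    refine convexHull_min (t := D) ?_ hD h
    rintro ⟨u, s⟩ ⟨y, hy, rfl, hs⟩
    refine ⟨fun z => if z = y then 1 else 0, ⟨fun z _ => ?_, ?_, fun i => ?_⟩, fun z _ hz => ?_, ?_⟩
    · dsimp only
      split_ifs <;> simp
    · simp [hy]
    · simp [hy, realVector]
    · have : z = y := by simpa using hz
      exact this ▸ hs.ne_top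
    · have := EReal.coe_toReal hs.ne_top (hf y)
      simp only at hs
      rw [← this] at hs
      simpa [hy] using hs
  · rintro ⟨lam, ⟨l0, l1, l2⟩, l3, l4⟩
    set N := integralNeighborhood x with hN
    set δ := r - ∑ y ∈ N, lam y * (f y).toReal with hδ
    have hsub : ∀ c : (Fin n → ℤ) → ℝ,
        ∑ y ∈ N with lam y ≠ 0, lam y * c y = ∑ y ∈ N, lam y * c y := by
      intro c
      refine Finset.sum_filter_of_ne fun y _ h h0 => h ?_
      simp [h0]
    -- Each point of the support is lifted by the total slack `δ`; as the weights sum to one, the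
    -- combination has height exactly `r`.
    have hmem := (convex_convexHull ℝ (localEpigraph f x)).sum_mem
      (t := {y ∈ N | lam y ≠ 0}) (w := lam) (z := fun y => (realVector y, (f y).toReal + δ))
      (fun y hy => l0 y (Finset.mem_filter.1 hy).1)
      (by simpa [l1] using hsub fun _ => 1)
      (fun y hy => by
        obtain ⟨hy, h0⟩ := Finset.mem_filter.1 hy
        refine subset_convexHull ℝ _ ⟨y, hy, rfl, ?_⟩
        conv_lhs => rw [← EReal.coe_toReal (l3 y hy h0) (hf y)]
        simp only
        exact_mod_cast (by linarith : (f y).toReal < (f y).toReal + δ))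
    convert hmem using 1
    refine Prod.ext ?_ ?_
    · ext i
      simp only [Prod.fst_sum, Prod.smul_fst, Finset.sum_apply, Pi.smul_apply, smul_eq_mul,
        realVector]
      rw [hsub, l2]
    · simp only [Prod.snd_sum, Prod.smul_snd, smul_eq_mul]
      rw [hsub]
      simp only [mul_add, Finset.sum_add_distrib, ← Finset.sum_mul, l1]
      rw [hδ]; ring

/-! ### Univariate discrete convex functions -/

namespace IsUnivariateDiscreteConvex

variable {ψ : ℤ → EReal}

theorem ne_top_of_between (hψ : IsUnivariateDiscreteConvex ψ) {j k l : ℤ} (hj : ψ j ≠ ⊤)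
    (hl : ψ l ≠ ⊤) (hjk : j ≤ k) (hkl : k ≤ l) : ψ k ≠ ⊤ := by
  have h : k ∈ {t : ℤ | ψ t < ⊤} := hψ.2.1.out (x := j) (y := l) (lt_top_iff_ne_top.2 hj)
    (lt_top_iff_ne_top.2 hl) ⟨hjk, hkl⟩
  exact (show ψ k < ⊤ from h).ne

theorem two_mul_toReal_le (hψ : IsUnivariateDiscreteConvex ψ) {j k l : ℤ} (hj : ψ j ≠ ⊤)
    (hl : ψ l ≠ ⊤) (hjk : k = j + 1) (hkl : l = k + 1) :
    2 * (ψ k).toReal ≤ (ψ j).toReal + (ψ l).toReal := by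
  have hk : ψ k ≠ ⊤ := hψ.ne_top_of_between hj hl (by omega) (by omega)
  have h := hψ.2.2 k
  rw [show k - 1 = j by omega, ← hkl, ← EReal.coe_toReal hj (hψ.1 j),
    ← EReal.coe_toReal hk (hψ.1 k), ← EReal.coe_toReal hl (hψ.1 l),
    show (2 : EReal) = ((2 : ℝ) : EReal) from rfl] at h
  exact_mod_cast h

/-- The line through two consecutive points of the graph supports the graph. -/
theorem line_le (hψ : IsUnivariateDiscreteConvex ψ) {m : ℤ} (h0 : ψ m ≠ ⊤)
    (h1 : ψ (m + 1) ≠ ⊤) {k : ℤ} (hk : ψ k ≠ ⊤) :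
    (ψ m).toReal + ((ψ (m + 1)).toReal - (ψ m).toReal) * ((k : ℝ) - m) ≤ (ψ k).toReal := by
  set s := (ψ (m + 1)).toReal - (ψ m).toReal with hs
  -- The slope bound is carried along to make the induction go through.
  have up : ∀ j : ℕ, ψ (m + 1 + j) ≠ ⊤ → s ≤ (ψ (m + 1 + j)).toReal - (ψ (m + j)).toReal ∧
      (ψ m).toReal + s * (j + 1) ≤ (ψ (m + 1 + j)).toReal := by
    intro j
    induction j with
    | zero => intro _; simp [hs]
    | succ j ih =>
      intro hj
      have hj1 : ψ (m + 1 + j) ≠ ⊤ :=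
        hψ.ne_top_of_between h1 hj (by omega) (by push_cast; omega)
      have hj0 : ψ (m + j) ≠ ⊤ := hψ.ne_top_of_between h0 hj (by omega) (by push_cast; omega)
      have h2 := hψ.two_mul_toReal_le hj0 hj (k := m + 1 + j) (by omega) (by push_cast; omega)
      obtain ⟨h3, h4⟩ := ih hj1
      rw [show m + ((j + 1 : ℕ) : ℤ) = m + 1 + j by push_cast; omega]
      push_cast at *
      constructor <;> linarith
  have down : ∀ j : ℕ, ψ (m - j) ≠ ⊤ → (ψ (m + 1 - j)).toReal - (ψ (m - j)).toReal ≤ s ∧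
      (ψ m).toReal - s * j ≤ (ψ (m - j)).toReal := by
    intro j
    induction j with
    | zero => intro _; simp [hs]
    | succ j ih =>
      intro hj
      have hj0 : ψ (m - j) ≠ ⊤ := hψ.ne_top_of_between hj h0 (by push_cast; omega) (by omega)
      have hj1 : ψ (m + 1 - j) ≠ ⊤ :=
        hψ.ne_top_of_between hj h1 (by push_cast; omega) (by omega)
      have h2 := hψ.two_mul_toReal_le hj hj1 (k := m - j) (by push_cast; omega) (by omega)
      obtain ⟨h3, h4⟩ := ih hj0
      rw [show m + 1 - ((j + 1 : ℕ) : ℤ) = m - j by push_cast; omega]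
      push_cast at *
      constructor <;> linarith
  rcases lt_or_ge m k with hmk | hmk
  · obtain ⟨j, hj⟩ := Int.eq_ofNat_of_zero_le (show 0 ≤ k - (m + 1) by omega)
    obtain rfl : k = m + 1 + j := by omega
    have := (up j hk).2
    push_cast
    linarith
  · obtain ⟨j, hj⟩ := Int.eq_ofNat_of_zero_le (show 0 ≤ m - k by omega)
    obtain rfl : k = m - j := by omega
    have := (down j hk).2
    push_cast
    linarith

end IsUnivariateDiscreteConvex

/-- The graph of `ψ` above its effective domain. -/
def finiteGraph (ψ : ℤ → EReal) : Set (ℝ × ℝ) :=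
  {p | ∃ k : ℤ, p.1 = k ∧ ψ k = p.2}

/-- With `C = 0` this bounds the effective domain; with `C = 1` it gives supporting lines. -/
theorem le_of_mem_convexHull_finiteGraph {ψ : ℤ → EReal} {A B C : ℝ}
    (h : ∀ k : ℤ, ψ k ≠ ⊤ → ψ k ≠ ⊥ → A + B * k ≤ C * (ψ k).toReal) {p : ℝ × ℝ}
    (hp : p ∈ convexHull ℝ (finiteGraph ψ)) : A + B * p.1 ≤ C * p.2 := by
  refine convexHull_min (t := {p : ℝ × ℝ | A + B * p.1 ≤ C * p.2}) ?_ ?_ hp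
  · rintro ⟨u, v⟩ ⟨k, hu, hv⟩
    simp only at hu hv
    have := h k (by simp [hv]) (by simp [hv])
    simpa [hv, hu] using this
  · rintro ⟨u, v⟩ hu ⟨u', v'⟩ hu' a b ha hb hab
    simp only [Set.mem_ofPred_eq, Prod.smul_mk, Prod.mk_add_mk, smul_eq_mul] at *
    have h1 := mul_le_mul_of_nonneg_left hu ha
    have h2 := mul_le_mul_of_nonneg_left hu' hb
    obtain rfl : b = 1 - a := by linarith
    linarith

theorem IsUnivariateDiscreteConvex.ne_top_of_mem_convexHull {ψ : ℤ → EReal}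
    (hψ : IsUnivariateDiscreteConvex ψ) {p : ℝ × ℝ} (hp : p ∈ convexHull ℝ (finiteGraph ψ))
    {m : ℤ} (h1 : p.1 < m + 1) (h2 : (m : ℝ) - 1 < p.1) : ψ m ≠ ⊤ := by
  intro htop
  -- The domain is an interval missing `m`, so it lies in `k ≤ m - 1` or in `k ≥ m + 1`, and so does
  -- `p.1`.
  by_cases hlow : ∃ j, j ≤ m ∧ ψ j ≠ ⊤
  · obtain ⟨j, hj, hjt⟩ := hlow
    have hle : (1 - m : ℝ) + 1 * p.1 ≤ 0 * p.2 := by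
      refine le_of_mem_convexHull_finiteGraph (fun k hk _ => ?_) hp
      have : k ≤ m - 1 := by
        by_contra hlt
        exact hψ.ne_top_of_between hjt hk hj (by omega) htop
      have : (k : ℝ) ≤ m - 1 := by exact_mod_cast this
      linarith
    linarith
  · have hle : (m + 1 : ℝ) + (-1) * p.1 ≤ 0 * p.2 := by
      refine le_of_mem_convexHull_finiteGraph (fun k hk _ => ?_) hp
      have : m + 1 ≤ k := by
        by_contra hlt
        exact hlow ⟨k, by omega, hk⟩
      have : (m + 1 : ℝ) ≤ k := by exact_mod_cast this
      linarith
    linarith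

/-- The piecewise linear interpolation of a discrete convex function is a lower bound for the
convex hull of its graph. -/
theorem IsUnivariateDiscreteConvex.interpolation_le {ψ : ℤ → EReal}
    (hψ : IsUnivariateDiscreteConvex ψ) {w τ : ℝ}
    (hp : (w, τ) ∈ convexHull ℝ (finiteGraph ψ)) :
    ψ ⌊w⌋ ≠ ⊤ ∧ (Int.fract w ≠ 0 → ψ (⌊w⌋ + 1) ≠ ⊤) ∧
      (ψ ⌊w⌋).toReal + Int.fract w * ((ψ (⌊w⌋ + 1)).toReal - (ψ ⌊w⌋).toReal) ≤ τ := by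
  have hw := Int.floor_add_fract w
  have hf0 := Int.fract_nonneg w
  have hf1 := Int.fract_lt_one w
  have h0 : ψ ⌊w⌋ ≠ ⊤ :=
    hψ.ne_top_of_mem_convexHull hp (by simp only; linarith) (by simp only; linarith)
  have h1 : Int.fract w ≠ 0 → ψ (⌊w⌋ + 1) ≠ ⊤ := by
    intro h
    have : 0 < Int.fract w := hf0.lt_of_ne' h
    exact hψ.ne_top_of_mem_convexHull hp (by push_cast; linarith) (by push_cast; linarith)
  refine ⟨h0, h1, ?_⟩
  have line : ∀ m : ℤ, ψ m ≠ ⊤ → ψ (m + 1) ≠ ⊤ →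
      (ψ m).toReal + ((ψ (m + 1)).toReal - (ψ m).toReal) * (w - m) ≤ τ := by
    intro m hm hm1
    have := le_of_mem_convexHull_finiteGraph
      (A := (ψ m).toReal - ((ψ (m + 1)).toReal - (ψ m).toReal) * m)
      (B := (ψ (m + 1)).toReal - (ψ m).toReal) (C := 1)
      (fun k hk _ => by linarith [hψ.line_le hm hm1 hk]) hp
    simp only at this
    linarith
  -- Here `w` is the right end of the domain: the line through `⌊w⌋ - 1` and `⌊w⌋` serves instead,
  -- or a horizontal one if the domain is a single point.
  by_cases h2 : ψ (⌊w⌋ + 1) = ⊤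
  · have hfr : Int.fract w = 0 := by
      by_contra h
      exact h1 h h2
    have hwm : w = ⌊w⌋ := by linarith
    rw [hfr, zero_mul, add_zero]
    by_cases h3 : ψ (⌊w⌋ - 1) = ⊤
    · have := le_of_mem_convexHull_finiteGraph (A := (ψ ⌊w⌋).toReal) (B := 0) (C := 1)
        (fun k hk _ => by
          obtain rfl : k = ⌊w⌋ := by
            rcases lt_trichotomy k ⌊w⌋ with h | h | h
            · exact absurd h3 (hψ.ne_top_of_between hk h0 (by omega) (by omega))
            · exact h
            · exact absurd h2 (hψ.ne_top_of_between h0 hk (by omega) (by omega))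
          linarith) hp
      simpa using this
    · have := line (⌊w⌋ - 1) h3 (by rwa [sub_add_cancel])
      rw [sub_add_cancel] at this
      push_cast at this
      have e : w - ((⌊w⌋ : ℝ) - 1) = 1 := by linarith
      rw [e] at this
      linarith
  · have := line ⌊w⌋ h0 h2
    rw [show w - ⌊w⌋ = Int.fract w from rfl] at this
    linarith

/-! ### The coupling -/

/-- Given a random rounding `Y` of `y`, an affine function of `Y` can serve as the probability of
rounding `z` up, conditionally on `Y`, in such a way that the sum of the rounded numbers is always
a rounding of `y + z`. -/
theorem exists_affine_rounding (y z : ℝ) : ∃ c d : ℝ, c + d * y = Int.fract z ∧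
    (Int.fract z = 0 → c = 0 ∧ d = 0) ∧
    ∀ Y : ℤ, |y - Y| < 1 → 0 ≤ c + d * Y ∧ c + d * Y ≤ 1 ∧
      (c + d * Y ≠ 1 → |y + z - ((Y + ⌊z⌋ : ℤ) : ℝ)| < 1) ∧
      (c + d * Y ≠ 0 → |y + z - ((Y + (⌊z⌋ + 1) : ℤ) : ℝ)| < 1) := by
  have hy := Int.floor_add_fract y
  have hz := Int.floor_add_fract z
  have ha0 := Int.fract_nonneg y
  have ha1 := Int.fract_lt_one y
  have hb0 := Int.fract_nonneg z
  have hb1 := Int.fract_lt_one z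
  push_cast
  generalize Int.fract y = a at *
  generalize Int.fract z = b at *
  generalize ⌊y⌋ = F at *
  generalize ⌊z⌋ = G at *
  subst hy hz
  have hround : ∀ Y : ℤ, |(F + a : ℝ) - Y| < 1 → Y = F ∨ (Y = F + 1 ∧ 0 < a) := by
    intro Y hY
    rw [abs_lt] at hY
    have h1 : F - 1 < Y := by
      exact_mod_cast (by push_cast; linarith : ((F - 1 : ℤ) : ℝ) < Y)
    have h2 : Y < F + 2 := by
      exact_mod_cast (by push_cast; linarith : (Y : ℝ) < ((F + 2 : ℤ) : ℝ))
    rcases (by omega : Y = F ∨ Y = F + 1) with rfl | rfl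
    · exact Or.inl rfl
    · refine Or.inr ⟨rfl, ?_⟩
      push_cast at hY
      linarith
  rcases hb0.eq_or_lt with rfl | hb
  · refine ⟨0, 0, by simp, by simp, fun Y hY => ⟨by simp, by simp, fun _ => ?_, by simp⟩⟩
    convert hY using 2
    ring
  -- With `a`, `b` the probabilities of rounding `y`, `z` up: if `a + b ≤ 1`, never round both up,
  -- so the conditional probability is `b / (1 - a)` when `Y = F` and `0` otherwise.
  rcases le_or_gt (a + b) 1 with hab | hab
  · have ha : 0 < 1 - a := by linarith
    have hle : b / (1 - a) ≤ 1 := by rw [div_le_one ha]; linarith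
    refine ⟨b / (1 - a) * (1 + F), -(b / (1 - a)), ?_, fun h => absurd h hb.ne', fun Y hY => ?_⟩
    · field_simp
      ring
    · rcases hround Y hY with rfl | ⟨rfl, ha'⟩
      · have e : b / (1 - a) * (1 + Y) + -(b / (1 - a)) * Y = b / (1 - a) := by ring
        rw [e]
        refine ⟨by positivity, hle, fun h => ?_, fun _ => ?_⟩
        · have : a + b ≠ 1 := by
            intro h'
            exact h (by rw [div_eq_one_iff_eq ha.ne']; linarith)
          have : a + b < 1 := lt_of_le_of_ne hab this
          rw [abs_lt]; constructor <;> linarith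
        · rw [abs_lt]; constructor <;> linarith
      · have e : b / (1 - a) * (1 + F) + -(b / (1 - a)) * ((F + 1 : ℤ) : ℝ) = 0 := by
          push_cast; ring
        rw [e]
        refine ⟨le_rfl, zero_le_one, fun _ => ?_, fun h => absurd rfl h⟩
        push_cast
        rw [abs_lt]; constructor <;> linarith
  -- Now never round both down: the conditional probability is `1` when `Y = F` and `1 - (1 - b) /
  -- a` otherwise.
  · have ha : 0 < a := by linarith
    have hle : (1 - b) / a < 1 := by rw [div_lt_one ha]; linarith
    have hpos : 0 < (1 - b) / a := div_pos (by linarith) ha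
    refine ⟨1 + (1 - b) / a * F, -((1 - b) / a), ?_, fun h => absurd h hb.ne', fun Y hY => ?_⟩
    · field_simp
      ring
    · rcases hround Y hY with rfl | ⟨rfl, -⟩
      · have e : 1 + (1 - b) / a * Y + -((1 - b) / a) * Y = 1 := by ring
        rw [e]
        refine ⟨zero_le_one, le_rfl, fun h => absurd rfl h, fun _ => ?_⟩
        rw [abs_lt]; constructor <;> linarith
      · have e : 1 + (1 - b) / a * F + -((1 - b) / a) * ((F + 1 : ℤ) : ℝ) = 1 - (1 - b) / a := by
          push_cast; ring
        rw [e]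
        push_cast
        refine ⟨by linarith, by linarith, fun _ => ?_, fun _ => ?_⟩ <;>
          (rw [abs_lt]; constructor <;> linarith)

/-- The sum of coordinate pairs, as a point of the space that contains the epigraphs. -/
def collectPairs (n : ℕ) : (Fin n → ℝ × ℝ) →ₗ[ℝ] (Fin n → ℝ) × ℝ where
  toFun p := (fun i => (p i).1, ∑ i, (p i).2)
  map_add' p q := by
    refine Prod.ext ?_ ?_
    · rfl
    · simp [Finset.sum_add_distrib]
  map_smul' a p := by
    refine Prod.ext ?_ ?_
    · rfl
    · simp [Finset.mul_sum]

theorem integerConvolution_le {n : ℕ} (f g : (Fin n → ℤ) → EReal) (y z : Fin n → ℤ) :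
    integerConvolution f g (y + z) ≤ f y + g z :=
  (iInf_le _ y).trans ((iInf_le _ z).trans (iInf_le _ rfl))

theorem localConvexExtension_integerConvolution_lt {n : ℕ} {f φ : (Fin n → ℤ) → EReal}
    {ψ : Fin n → ℤ → EReal} (hf : ∀ x, f x ≠ ⊥)
    (hψ : ∀ i, IsUnivariateDiscreteConvex (ψ i)) (hφ : ∀ x, φ x = ∑ i, ψ i (x i))
    (hbdd : ∀ x, integerConvolution f φ x ≠ ⊥) {y z τ : Fin n → ℝ} {s : ℝ}
    (hy : localConvexExtension f y < s)
    (hz : ∀ i, (z i, τ i) ∈ convexHull ℝ (finiteGraph (ψ i))) :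
    localConvexExtension (integerConvolution f φ) (y + z) < ((s + ∑ i, τ i : ℝ) : EReal) := by
  choose hfin0 hfin1 hτ using fun i => (hψ i).interpolation_le (hz i)
  choose c d hcd hzero hround using fun i => exists_affine_rounding (y i) (z i)
  let α : Fin n → ℝ := fun i => (ψ i ⌊z i⌋).toReal
  let β : Fin n → ℝ := fun i => (ψ i (⌊z i⌋ + 1)).toReal
  -- Conditional mean, given `Y`, of the rounded `z i` and its cost, extended affinely to real `Y`.
  let pair : (Fin n → ℝ) → Fin n → ℝ × ℝ := fun Y i =>
    (⌊z i⌋ + (c i + d i * Y i), α i + (c i + d i * Y i) * (β i - α i))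
  let A : (Fin n → ℝ) × ℝ → (Fin n → ℝ) × ℝ := fun p => p + collectPairs n (pair p.1)
  let T := convexHull ℝ (localEpigraph (integerConvolution f φ) (y + z))
  have hpair : ∀ Y Y' : Fin n → ℝ, ∀ a b : ℝ, a + b = 1 →
      pair (a • Y + b • Y') = a • pair Y + b • pair Y' := by
    intro Y Y' a b hab
    obtain rfl : b = 1 - a := by linarith
    funext i
    refine Prod.ext ?_ ?_ <;> simp only [pair, Pi.add_apply, Pi.smul_apply, smul_eq_mul,
      Prod.fst_add, Prod.snd_add, Prod.smul_fst, Prod.smul_snd] <;> ring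
  have hconv : Convex ℝ (A ⁻¹' T) := by
    intro p hp q hq a b ha hb hab
    have : A (a • p + b • q) = a • A p + b • A q := by
      simp only [A, Prod.fst_add, Prod.smul_fst, hpair _ _ _ _ hab, map_add, map_smul, smul_add]
      abel
    rw [Set.mem_preimage, this]
    exact convex_convexHull ℝ _ hp hq ha hb hab
  -- Since `A` is affine, only integer `Y` in `N(y)` need checking. There the coordinates of `z` are
  -- rounded independently: a product of hulls is the hull of the product.
  have hsub : localEpigraph f y ⊆ A ⁻¹' T := by
    rintro ⟨u, ρ⟩ ⟨Y, hY, rfl, hρ⟩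
    rw [mem_integralNeighborhood] at hY
    let P : Fin n → Set (ℝ × ℝ) := fun i =>
      {p | ∃ k : ℤ, |y i + z i - ((Y i + k : ℤ) : ℝ)| < 1 ∧ p.1 = k ∧ ψ i k = p.2}
    have hmem : pair (realVector Y) ∈ convexHull ℝ (Set.univ.pi P) := by
      rw [convexHull_pi]
      intro i _
      obtain ⟨k0, k1, hlow, hup⟩ := hround i (Y i) (hY i)
      have elow : c i + d i * Y i ≠ 1 → ((⌊z i⌋ : ℝ), α i) ∈ P i := fun h =>
        ⟨⌊z i⌋, hlow h, rfl, (EReal.coe_toReal (hfin0 i) ((hψ i).1 _)).symm⟩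
      have eup : c i + d i * Y i ≠ 0 → ((⌊z i⌋ + 1 : ℝ), β i) ∈ P i := fun h =>
        ⟨⌊z i⌋ + 1, hup h, by push_cast; rfl, (EReal.coe_toReal (hfin1 i fun h0 => h (by
          simp [hzero i h0])) ((hψ i).1 _)).symm⟩
      have epair : pair (realVector Y) i =
          (1 - (c i + d i * Y i)) • ((⌊z i⌋ : ℝ), α i) +
            (c i + d i * Y i) • ((⌊z i⌋ + 1 : ℝ), β i) := by
        refine Prod.ext ?_ ?_ <;> simp only [pair, realVector, smul_eq_mul,
          Prod.fst_add, Prod.snd_add, Prod.smul_fst, Prod.smul_snd] <;> ring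
      rw [epair]
      by_cases h0 : c i + d i * Y i = 0
      · rw [h0, sub_zero, one_smul, zero_smul, add_zero]
        exact subset_convexHull ℝ _ (elow (by rw [h0]; exact zero_ne_one))
      by_cases h1 : c i + d i * Y i = 1
      · rw [h1, sub_self, one_smul, zero_smul, zero_add]
        exact subset_convexHull ℝ _ (eup h0)
      exact convex_convexHull ℝ _ (subset_convexHull ℝ _ (elow h1)) (subset_convexHull ℝ _ (eup h0))
        (by linarith) k0 (by ring)
    have himage : ∀ p ∈ Set.univ.pi P, (realVector Y, ρ) + collectPairs n p ∈
        localEpigraph (integerConvolution f φ) (y + z) := by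
      intro p hp
      choose k hk hk1 hk2 using fun i => hp i (Set.mem_univ i)
      refine ⟨Y + k, (mem_integralNeighborhood _ _).2 hk, ?_, ?_⟩
      · funext i
        simp [collectPairs, realVector, hk1]
      · refine (integerConvolution_le f φ Y k).trans_lt ?_
        rw [hφ, Finset.sum_congr rfl fun i _ => hk2 i, ← EReal.coe_sum]
        exact EReal.add_lt_add_right_coe hρ _
    have hpre : Convex ℝ {p | (realVector Y, ρ) + collectPairs n p ∈ T} :=
      ((convex_convexHull ℝ _).translate_preimage_right _).linear_preimage (collectPairs n)
    exact convexHull_min (t := {p | (realVector Y, ρ) + collectPairs n p ∈ T})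
      (fun p hp => subset_convexHull ℝ _ (himage p hp)) hpre hmem
  have hA : A (y, s) ∈ T :=
    convexHull_min hsub hconv ((mem_convexHull_localEpigraph hf y s).2 hy)
  have hAeq : A (y, s) = (y + z, s + ∑ i, (α i + Int.fract (z i) * (β i - α i))) := by
    refine Prod.ext ?_ ?_
    · funext i
      simp [A, collectPairs, pair, hcd]
    · simp [A, collectPairs, pair, hcd]
  rw [hAeq] at hA
  refine ((mem_convexHull_localEpigraph hbdd _ _).1 hA).trans_le ?_
  exact_mod_cast add_le_add_right (Finset.sum_le_sum fun i _ => hτ i) s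

/-! ### The integer points of the epigraphs -/

/-- The strict epigraph of `f` above all integer points. -/
def integerEpigraph {n : ℕ} (f : (Fin n → ℤ) → EReal) : Set ((Fin n → ℝ) × ℝ) :=
  {p | ∃ y, p.1 = realVector y ∧ f y < p.2}

theorem localConvexExtension_lt_of_lt {n : ℕ} {f : (Fin n → ℤ) → EReal} (hf : ∀ y, f y ≠ ⊥)
    {y : Fin n → ℤ} {r : ℝ} (h : f y < r) : localConvexExtension f (realVector y) < r := by
  refine (mem_convexHull_localEpigraph hf _ _).1 (subset_convexHull ℝ _ ⟨y, ?_, rfl, h⟩)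
  simp [mem_integralNeighborhood, realVector]

/-- The only use of convexity of the local extension of `f`: it replaces arbitrary integer points by
neighbors of `p.1`. -/
theorem IsIntegrallyConvex.lt_of_mem_convexHull {n : ℕ} {f : (Fin n → ℤ) → EReal}
    (hf : IsIntegrallyConvex f) {p : (Fin n → ℝ) × ℝ}
    (hp : p ∈ convexHull ℝ (integerEpigraph f)) : localConvexExtension f p.1 < p.2 := by
  refine convexHull_min ?_
    (hf.2.convex_strictEpigraph (localConvexExtension_ne_bot hf.1)) hp
  rintro ⟨u, r⟩ ⟨y, rfl, h⟩
  exact localConvexExtension_lt_of_lt hf.1 h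

open scoped Pointwise in
theorem integerEpigraph_integerConvolution_subset {n : ℕ} {f φ : (Fin n → ℤ) → EReal}
    {ψ : Fin n → ℤ → EReal} (hf : ∀ x, f x ≠ ⊥) (hψ : ∀ i t, ψ i t ≠ ⊥)
    (hφ : ∀ x, φ x = ∑ i, ψ i (x i)) :
    integerEpigraph (integerConvolution f φ) ⊆
      integerEpigraph f + collectPairs n '' Set.univ.pi fun i => finiteGraph (ψ i) := by
  rintro ⟨u, r⟩ ⟨x, rfl, h⟩
  simp only [integerConvolution, iInf_lt_iff] at h
  obtain ⟨y, z, rfl, h⟩ := h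
  have hbot : φ z ≠ ⊥ := by
    rw [hφ]
    exact EReal.sum_ne_bot fun i _ => hψ i _
  have htop : φ z ≠ ⊤ := ((EReal.add_ne_top_iff_ne_top₂ (hf y) hbot).1 h.ne_top).2
  rw [hφ] at htop h
  have hfin : ∀ i, ψ i (z i) ≠ ⊤ := fun i =>
    EReal.ne_top_of_sum_ne_top (fun i _ => hψ i _) htop i (Finset.mem_univ i)
  have hcoe : ∀ i, ψ i (z i) = ((ψ i (z i)).toReal : EReal) := fun i =>
    (EReal.coe_toReal (hfin i) (hψ i _)).symm
  rw [Finset.sum_congr rfl fun i _ => hcoe i, ← EReal.coe_sum] at h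
  -- All slack goes to the `f` summand, so the other one lies exactly on the graphs.
  refine Set.mem_add.2 ⟨(realVector y, r - ∑ i, (ψ i (z i)).toReal), ⟨y, rfl, ?_⟩, _,
    ⟨fun i => ((z i : ℝ), (ψ i (z i)).toReal), fun i _ => ⟨z i, rfl, hcoe i⟩, rfl⟩, ?_⟩
  · obtain ⟨v, hv⟩ : ∃ v : ℝ, f y = v := by
      refine ⟨_, (EReal.coe_toReal ?_ (hf y)).symm⟩
      exact ((EReal.add_ne_top_iff_ne_top₂ (hf y) (EReal.coe_ne_bot _)).1 h.ne_top).1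
    rw [hv] at h ⊢
    norm_cast at h ⊢
    simp only
    linarith
  · refine Prod.ext ?_ ?_
    · funext i
      simp [collectPairs, realVector]
    · simp [collectPairs]

theorem mainTheorem1 (n : ℕ) (f φ : (Fin n → ℤ) → EReal)
    (hf : IsIntegrallyConvex f) (hφ : IsSeparableConvex φ)
    (hbdd : ∀ x, integerConvolution f φ x ≠ ⊥) :
    IsIntegrallyConvex (integerConvolution f φ) := by
  obtain ⟨ψ, hψ, hφ⟩ := hφ
  refine ⟨hbdd, isConvexExtended_of_convex_strictEpigraph ?_ (localConvexExtension_ne_bot hbdd)⟩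
  suffices h : {p : (Fin n → ℝ) × ℝ | localConvexExtension (integerConvolution f φ) p.1 < p.2} =
      convexHull ℝ (integerEpigraph (integerConvolution f φ)) from h ▸ convex_convexHull ℝ _
  refine Set.Subset.antisymm ?_ ?_
  · rintro ⟨x, r⟩ h
    refine convexHull_mono ?_ ((mem_convexHull_localEpigraph hbdd x r).2 h)
    rintro p ⟨y, -, hy⟩
    exact ⟨y, hy⟩
  · intro p hp
    have h := convexHull_mono
      (integerEpigraph_integerConvolution_subset hf.1 (fun i => (hψ i).1) hφ) hp
    -- Convex hulls commute with Minkowski sums, linear images and products, which splits the point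
    -- coordinatewise in the `φ` part.
    rw [convexHull_add, ← LinearMap.image_convexHull, convexHull_pi] at h
    obtain ⟨⟨y, s⟩, hy, _, ⟨q, hq, rfl⟩, rfl⟩ := Set.mem_add.1 h
    exact localConvexExtension_integerConvolution_lt hf.1 hψ hφ hbdd
      (hf.lt_of_mem_convexHull hy) fun i => hq i (Set.mem_univ i)
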